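/- **Conventions.** Let $n\ge 1$ and equip $\mathbb C^n$ with the Euclidean norm $|\cdot|$; $\mathbb B^n(z,r)$ is the open ball of centre $z$ and radius $r$, and $|A|$ is the Lebesgue measure of $A\subset\mathbb C^n\cong\mathbb R^{2n}$. A *majorant* is a continuous increasing (i.e. non-decreasing) function $\psi:[0,\infty)\to[0,\infty)$ with $\psi(0)=0$ such that $\psi(t)/t$ is non-increasing for $t>0$; it is *fast* if there are $\delta_0>0$ and $C>0$ with $\int_0^\delta \frac{\psi(t)}{t}\,dt\le C\psi(\delta)$ for all $0<\delta<\delta_0$. For a proper subdomain $\Omega\subsetneq\mathbb C^n$ (non-empty, open, connected) let $d_\Omega(z)$ be the Euclidean distance from $z$ to $\partial\Omega$. A real- or complex-valued function $g$ on $\Omega$ belongs to $\mathscr L_\psi(\Omega)$ if there is $C>0$ with $|g(z)-g(w)|\le C\psi(|z-w|)$ for all $z,w\in\Omega$, and to $\mathrm{loc}\mathscr L_\psi(\Omega)$ if there is $C>0$ such that this inequality holds whenever $z\in\Omega$ and $|z-w|<\frac12 d_\Omega(z)$. The domain $\Omega$ is an *$\mathscr L_\psi$-extension domain* if $\mathscr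 L_\psi(\Omega)=\mathrm{loc}\mathscr L_\psi(\Omega)$. A function $g$ on $\Omega$ belongs to $\mathscr L_\psi(\Omega,\partial\Omega)$ if it extends to a continuous function $g$ on $\Omega\cup\partial\Omega$ for which there is $C>0$ with $|g(z)-g(w)|\le C\psi(|z-w|)$ for all $z\in\Omega$, $w\in\partial\Omega$. For a real-valued differentiable $u$ and $z=(x_1+iy_1,\dots,x_n+iy_n)$ put $\nabla u=(u_{x_1},u_{y_1},\dots,u_{x_n},u_{y_n})$, and for $p>0$ $$I_{u,p}(z)=\left(\frac1{|B_z|}\int_{B_z}|\nabla u|^p\,d\mu\right)^{1/p},\qquad B_z=\mathbb B^n\big(z,\tfrac12 d_{\Omega}(z)\big),$$ where $\mu$ is Lebesgue measure. **Theorem.** Let $\psi$ be a fast majorant, let $\mathscr E\subset\mathbb C^n$ be an $\mathscr L_\psi$-extension domain, and let $f=u+iv$ be holomorphic in $\mathscr E$, with $u,v$ real-valued. Let $p,q$ be given exponents with $p,q\ge\frac{2n-2}{2n-1}$ if $n\ge2$, and $p,q>0$ if $n=1$. Then the following eleven statements are equivalent. 1. $u\in\mathscr L_\psi(\mathscr E)$;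 2. there is $C>0$ with $|\nabla u(z)|\le C\,\psi(d_{\mathscr E}(z))/d_{\mathscr E}(z)$ for all $z\in\mathscr E$; 3. $|u|\in\mathscr L_\psi(\mathscr E)$; 4. there is $C>0$ with $I_{u,p}(z)\le C\,\psi(d_{\mathscr E}(z))/d_{\mathscr E}(z)$ for all $z\in\mathscr E$ (with $\Omega=\mathscr E$ in the definition of $I_{u,p}$); 5. $v\in\mathscr L_\psi(\mathscr E)$; 6. there is $C>0$ with $|\nabla v(z)|\le C\,\psi(d_{\mathscr E}(z))/d_{\mathscr E}(z)$ for all $z\in\mathscr E$; 7. $|v|\in\mathscr L_\psi(\mathscr E)$; 8. there is $C>0$ with $I_{v,q}(z)\le C\,\psi(d_{\mathscr E}(z))/d_{\mathscr E}(z)$ for all $z\in\mathscr E$; 9. $f\in\mathscr L_\psi(\mathscr E)$; 10. $|f|\in\mathscr L_\psi(\mathscr E)$; 11. $|f|\in\mathscr L_\psi(\mathscr E,\partial\mathscr E)$. -/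

import Mathlib

noncomputable section

/-- `ℂⁿ` with the Euclidean norm. -/
abbrev CSpace (n : ℕ) : Type := EuclideanSpace ℂ (Fin n)

/-- A majorant: a continuous increasing function `ψ : [0, ∞) → [0, ∞)` with `ψ 0 = 0` and
`ψ t / t` non-increasing for `t > 0`. It is given as a function on `ℝ` of which only the values
on `[0, ∞)` matter; nonnegativity there follows from the first two fields. -/
structure IsMajorant (ψ : ℝ → ℝ) : Prop where
  map_zero : ψ 0 = 0
  monotoneOn : MonotoneOn ψ (Set.Ici 0)
  continuousOn : ContinuousOn ψ (Set.Ici 0)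
  antitoneOn_div : AntitoneOn (fun t => ψ t / t) (Set.Ioi 0)

/-- A majorant is fast if `∫₀^δ ψ(t)/t dt ≤ C ψ(δ)` (in particular the integral is finite)
for all sufficiently small `δ > 0`. -/
structure IsFastMajorant (ψ : ℝ → ℝ) : Prop extends IsMajorant ψ where
  fast : ∃ δ₀ > 0, ∃ C > 0, ∀ δ, 0 < δ → δ < δ₀ →
    MeasureTheory.IntegrableOn (fun t => ψ t / t) (Set.Ioc 0 δ) ∧
      ∫ t in Set.Ioc 0 δ, ψ t / t ≤ C * ψ δ

/-- The Euclidean distance `d_Ω(z)` from `z` to the boundary of `Ω`. -/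
def bdryDist {n : ℕ} (Ω : Set (CSpace n)) (z : CSpace n) : ℝ :=
  Metric.infDist z (frontier Ω)

/-- The restriction of `f` to `Ω` belongs to the Lipschitz space `𝓛_ψ(Ω)`. -/
def MemLip {n : ℕ} {F : Type*} [NormedAddCommGroup F] (ψ : ℝ → ℝ) (Ω : Set (CSpace n))
    (f : CSpace n → F) : Prop :=
  ∃ C > 0, ∀ z ∈ Ω, ∀ w ∈ Ω, ‖f z - f w‖ ≤ C * ψ ‖z - w‖

/-- The restriction of `f` to `Ω` belongs to the local Lipschitz space `loc 𝓛_ψ(Ω)`.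
For open `Ω`, a point `w` with `‖z - w‖ < d_Ω(z) / 2` lies in `Ω` automatically. -/
def MemLocLip {n : ℕ} {F : Type*} [NormedAddCommGroup F] (ψ : ℝ → ℝ) (Ω : Set (CSpace n))
    (f : CSpace n → F) : Prop :=
  ∃ C > 0, ∀ z ∈ Ω, ∀ w, ‖z - w‖ < bdryDist Ω z / 2 → ‖f z - f w‖ ≤ C * ψ ‖z - w‖

/-- An `𝓛_ψ`-extension domain: a proper subdomain `Ω` of `ℂⁿ` with `𝓛_ψ(Ω) = loc 𝓛_ψ(Ω)`. -/
structure IsLipExtensionDomain {n : ℕ} (ψ : ℝ → ℝ) (Ω : Set (CSpace n)) : Prop where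
  isOpen : IsOpen Ω
  isConnected : IsConnected Ω
  ne_univ : Ω ≠ Set.univ
  memLip_iff : ∀ g : CSpace n → ℂ, MemLip ψ Ω g ↔ MemLocLip ψ Ω g

/-- `g`, as a function on `E₁ ∪ E₂`, belongs to `𝓛_ψ(E₁, E₂)`. -/
def MemLipBetween {n : ℕ} {F : Type*} [NormedAddCommGroup F] (ψ : ℝ → ℝ)
    (E₁ E₂ : Set (CSpace n)) (g : CSpace n → F) : Prop :=
  ContinuousOn g (E₁ ∪ E₂) ∧ ∃ C > 0, ∀ z ∈ E₁, ∀ w ∈ E₂, ‖g z - g w‖ ≤ C * ψ ‖z - w‖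

/-- A function given on `Ω` belongs to `𝓛_ψ(Ω, ∂Ω)`: it has an extension to `Ω ∪ ∂Ω`
(necessarily its unique continuous extension) in that class. -/
def MemLipBdry {n : ℕ} {F : Type*} [NormedAddCommGroup F] (ψ : ℝ → ℝ) (Ω : Set (CSpace n))
    (f : CSpace n → F) : Prop :=
  ∃ g : CSpace n → F, Set.EqOn g f Ω ∧ MemLipBetween ψ Ω (frontier Ω) g

/-- The real gradient of `u` at `z`: the partial derivatives `u_{x_j}` (left summand) and
`u_{y_j}` (right summand), where `z_j = x_j + i y_j`. -/
def realGrad {n : ℕ} (u : CSpace n → ℝ) (z : CSpace n) : EuclideanSpace ℝ (Fin n ⊕ Fin n) :=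
  WithLp.toLp 2 (Sum.elim
    (fun j => fderiv ℝ u z (EuclideanSpace.single j (1 : ℂ)))
    (fun j => fderiv ℝ u z (EuclideanSpace.single j Complex.I)))

/-- `|∇u(z)| ≤ C ψ(d_Ω(z)) / d_Ω(z)` on `Ω`, for some constant `C > 0`. -/
def GradBound {n : ℕ} (ψ : ℝ → ℝ) (Ω : Set (CSpace n)) (u : CSpace n → ℝ) : Prop :=
  ∃ C > 0, ∀ z ∈ Ω, ‖realGrad u z‖ ≤ C * (ψ (bdryDist Ω z) / bdryDist Ω z)

/-- The local `L^p` average of the gradient,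
`I_{u,p}(z) = |B|^{-1/p} (∫_B |∇u|^p dμ)^{1/p}` with `B = B(z, d_Ω(z)/2)` and `μ` the Lebesgue
measure. For `u` continuously differentiable on `Ω` and `z ∈ Ω` the integrand is bounded and
continuous on `B`, because `B` is relatively compact in `Ω`. -/
def gradMean {n : ℕ} (Ω : Set (CSpace n)) (u : CSpace n → ℝ) (p : ℝ) (z : CSpace n) : ℝ :=
  (MeasureTheory.volume.real (Metric.ball z (bdryDist Ω z / 2))) ^ (-(1 / p)) *
    (∫ w in Metric.ball z (bdryDist Ω z / 2), ‖realGrad u w‖ ^ p) ^ (1 / p)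

/-- `I_{u,p}(z) ≤ C ψ(d_Ω(z)) / d_Ω(z)` on `Ω`, for some constant `C > 0`. -/
def GradMeanBound {n : ℕ} (ψ : ℝ → ℝ) (Ω : Set (CSpace n)) (u : CSpace n → ℝ) (p : ℝ) : Prop :=
  ∃ C > 0, ∀ z ∈ Ω, gradMean Ω u p z ≤ C * (ψ (bdryDist Ω z) / bdryDist Ω z)

/-- The exponents allowed in dimension `n`: `p ≥ (2n-2)/(2n-1)` if `n ≥ 2`,
and `p > 0` if `n = 1`. -/
def AdmissibleExponent (n : ℕ) (p : ℝ) : Prop :=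
  0 < p ∧ (2 ≤ n → (2 * (n : ℝ) - 2) / (2 * (n : ℝ) - 1) ≤ p)

end

/-! Every statement is compared with one condition, `DerivBound`: |f'(z)| ≤ Cψ(d(z))/d(z). By the
Cauchy–Riemann equations |∇u| = |∇v| = |f'|, so the pointwise gradient bounds are this condition
itself. It gives f ∈ 𝓛_ψ: on half balls the mean value inequality makes f locally Lipschitz
(`DerivBound.memLocLip`), and the extension property makes this global. The other Lipschitz
statements then follow by triangle inequalities and continuous extension to the boundary. For the
converse, a bound on the growth of |f|, |u| or |v| over B(z, d(z)) becomes, after multiplying f by a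
unimodular constant, a one-sided bound on a real part; Borel–Carathéodory turns it into a derivative
bound (`norm_fderiv_le_of_re_le`). The integral means are handled by the sub-mean value property of
|f'|^p for every p > 0 (`norm_fderiv_rpow_mul_volume_le`), which rests on Jensen's formula along
complex lines. -/

open Metric Set Filter Topology

/-! ### Borel–Carathéodory estimates and subharmonicity of |g|^p. -/

section ComplexAnalysis

variable {V : Type*} [NormedAddCommGroup V] [NormedSpace ℂ V]

/-- A gradient form of the Borel–Carathéodory inequality: a one-sided bound on the oscillation of
the real part on a ball controls the derivative at the centre. -/
theorem norm_fderiv_le_of_re_le {f : V → ℂ} {z : V} {R M : ℝ} (hR : 0 < R)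
    (hf : DifferentiableOn ℂ f (ball z R)) (hM : ∀ w ∈ ball z R, (f w).re ≤ (f z).re + M) :
    ‖fderiv ℂ f z‖ ≤ 4 * M / R := by
  have hM0 : 0 ≤ M := by linarith [hM z (mem_ball_self hR)]
  -- M' > M ensures the strict positivity that Borel–Carathéodory requires; the limit M' → M is
  -- taken at the end.
  have key : ∀ M' > M, ‖fderiv ℂ f z‖ ≤ 2 * M' / (R / 2) := by
    intro M' hM'
    refine Complex.norm_fderiv_le_div_of_mapsTo_ball
      (hf.mono (ball_subset_ball (by linarith))) ?_ (by linarith)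
    intro w hw
    -- Since |w - z| < R/2, the disc |ζ| < 2 on the line through z and w stays in the ball;
    -- Borel–Carathéodory at ζ = 1 gives |f w - f z| ≤ 2M'·1/(2 - 1).
    have hmem : ∀ ζ ∈ ball (0 : ℂ) 2, z + ζ • (w - z) ∈ ball z R := by
      intro ζ hζ
      rw [mem_ball_zero_iff] at hζ
      rw [mem_ball_iff_norm] at hw
      rw [mem_ball_iff_norm, add_sub_cancel_left, norm_smul]
      nlinarith [norm_nonneg ζ, norm_nonneg (w - z)]
    have hbc := Complex.borelCaratheodory_zero (M := M') (R := 2) (z := 1)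
      (f := fun ζ : ℂ => f (z + ζ • (w - z)) - f z) (by linarith)
      ((hf.comp (by fun_prop) hmem).sub_const _)
      (fun ζ hζ => by
        have := hM _ (hmem ζ hζ)
        simp only [mem_ofPred_eq, Complex.sub_re]
        linarith)
      (by norm_num) (by simp) (by simp)
    rw [mem_closedBall_iff_norm]
    norm_num at hbc
    simpa using hbc
  have hlim : Tendsto (fun M' : ℝ => 2 * M' / (R / 2)) (𝓝[>] M) (𝓝 (2 * M / (R / 2))) :=
    (Continuous.tendsto (by fun_prop) M).mono_left nhdsWithin_le_nhds
  have := ge_of_tendsto hlim (eventually_nhdsWithin_of_forall key)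
  calc _ ≤ _ := this
    _ = 4 * M / R := by field_simp; ring

theorem norm_fderiv_le_of_re_mul_le {f : V → ℂ} {z : V} {R M : ℝ} {c : ℂ} (hc : ‖c‖ = 1)
    (hR : 0 < R) (hf : DifferentiableOn ℂ f (ball z R))
    (hM : ∀ w ∈ ball z R, (c * f w).re ≤ (c * f z).re + M) :
    ‖fderiv ℂ f z‖ ≤ 4 * M / R := by
  have h := norm_fderiv_le_of_re_le (f := fun w => c * f w) hR (hf.const_mul c) hM
  rwa [fderiv_const_mul (hf.differentiableAt (ball_mem_nhds z hR)), norm_smul, hc, one_mul] at h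

/-- Rotate f so that its value at z is |f z|: the real part then equals the modulus at the centre
and is at most the modulus elsewhere. -/
theorem norm_fderiv_le_of_norm_le {f : V → ℂ} {z : V} {R M : ℝ}
    (hR : 0 < R) (hf : DifferentiableOn ℂ f (ball z R))
    (hM : ∀ w ∈ ball z R, ‖f w‖ ≤ ‖f z‖ + M) :
    ‖fderiv ℂ f z‖ ≤ 4 * M / R := by
  obtain ⟨c, hc, hcz⟩ : ∃ c : ℂ, ‖c‖ = 1 ∧ c * f z = ‖f z‖ := by
    rcases eq_or_ne (f z) 0 with h | h
    · exact ⟨1, by simp [h]⟩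
    · have h' : (‖f z‖ : ℂ) ≠ 0 := by simpa using h
      refine ⟨‖f z‖ / f z, by simp [h], by field_simp⟩
  refine norm_fderiv_le_of_re_mul_le hc hR hf fun w hw => ?_
  calc (c * f w).re ≤ ‖c * f w‖ := Complex.re_le_norm _
    _ = ‖f w‖ := by rw [norm_mul, hc, one_mul]
    _ ≤ ‖f z‖ + M := hM w hw
    _ = _ := by rw [hcz, Complex.ofReal_re]

/-- The sign of the real part at the centre decides between c and -c. -/
theorem norm_fderiv_le_of_abs_re_mul_le {f : V → ℂ} {z : V} {R M : ℝ} {c : ℂ} (hc : ‖c‖ = 1)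
    (hR : 0 < R) (hf : DifferentiableOn ℂ f (ball z R))
    (hM : ∀ w ∈ ball z R, |(c * f w).re| ≤ |(c * f z).re| + M) :
    ‖fderiv ℂ f z‖ ≤ 4 * M / R := by
  rcases le_total 0 (c * f z).re with h | h
  · refine norm_fderiv_le_of_re_mul_le hc hR hf fun w hw => ?_
    have := hM w hw
    rw [abs_of_nonneg h] at this
    exact (le_abs_self _).trans this
  · refine norm_fderiv_le_of_re_mul_le (c := -c) (by rwa [norm_neg]) hR hf fun w hw => ?_
    have := hM w hw
    rw [abs_of_nonpos h] at this
    simp only [neg_mul, Complex.neg_re]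
    exact (neg_le_abs _).trans this

/-- The derivative of a holomorphic function in a fixed direction is holomorphic along complex
lines. -/
theorem differentiableOn_fderiv_apply_line {f : V → ℂ} {E : Set V} (hE : IsOpen E)
    (hf : DifferentiableOn ℂ f E) (z x e : V) :
    DifferentiableOn ℂ (fun ζ : ℂ => fderiv ℂ f (z + ζ • x) e)
      ((fun ζ : ℂ => z + ζ • x) ⁻¹' E) := by
  have hcont : Continuous (fun ζ : ℂ => z + ζ • x) := by fun_prop
  have hdiff : ∀ y, Differentiable ℂ (fun ζ : ℂ => z + ζ • x + y) := fun y => by fun_prop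
  intro ζ₀ hζ₀
  obtain ⟨r, hr, hball⟩ : ∃ r > 0,
      ball (z + ζ₀ • x) r ⊆ E ∩ {y | dist (f y) (f (z + ζ₀ • x)) < 1} := by
    refine Metric.mem_nhds_iff.1 (inter_mem (hE.mem_nhds hζ₀) ?_)
    exact (hf.continuousOn.continuousAt (hE.mem_nhds hζ₀)).eventually
      (Metric.ball_mem_nhds _ one_pos)
  obtain ⟨s, hs, hse⟩ : ∃ s > 0, s * ‖e‖ ≤ r / 2 := by
    refine ⟨r / 2 / (‖e‖ + 1), by positivity, ?_⟩
    rw [div_mul_eq_mul_div, div_le_iff₀ (by positivity)]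
    nlinarith [norm_nonneg e]
  set W : Set ℂ := (fun ζ : ℂ => z + ζ • x) ⁻¹' ball (z + ζ₀ • x) (r / 2) with hW
  have hWo : IsOpen W := isOpen_ball.preimage hcont
  have hWmem : ∀ ζ ∈ W, ∀ t ∈ ball (0 : ℂ) s, z + ζ • x + t • e ∈ ball (z + ζ₀ • x) r := by
    intro ζ hζ t ht
    rw [mem_ball_zero_iff] at ht
    have h1 : ‖z + ζ • x - (z + ζ₀ • x)‖ < r / 2 := mem_ball_iff_norm.1 hζ
    have h2 : ‖t • e‖ ≤ r / 2 := by
      rw [norm_smul]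
      exact (mul_le_mul_of_nonneg_right ht.le (norm_nonneg e)).trans hse
    rw [mem_ball_iff_norm]
    calc _ = ‖(z + ζ • x - (z + ζ₀ • x)) + t • e‖ := by congr 1; abel
      _ ≤ _ := norm_add_le _ _
      _ < r := by linarith
  -- Schwarz lemma applied to the difference quotient: f oscillates by at most 2, so the quotient is
  -- at most 2/s and oscillates by at most 4/s. The estimate does not depend on ζ, hence convergence
  -- as t → 0 is uniform.
  have hest : ∀ ζ ∈ W, ∀ t ∈ ball (0 : ℂ) s,
      ‖dslope (fun t : ℂ => f (z + ζ • x + t • e)) 0 t - fderiv ℂ f (z + ζ • x) e‖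
        ≤ (4 / s) / s * ‖t‖ := by
    intro ζ hζ t ht
    set g : ℂ → ℂ := fun t => f (z + ζ • x + t • e) with hg
    have hmem := hWmem ζ hζ
    have hgd : DifferentiableOn ℂ g (ball 0 s) :=
      hf.comp (by fun_prop) fun t ht => (hball (hmem t ht)).1
    have hgm : MapsTo g (ball 0 s) (closedBall (g 0) 2) := by
      intro t ht
      have h1 : dist (g t) (f (z + ζ₀ • x)) < 1 := (hball (hmem t ht)).2
      have h2 : dist (g 0) (f (z + ζ₀ • x)) < 1 := (hball (hmem 0 (mem_ball_self hs))).2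
      rw [mem_closedBall]
      linarith [dist_triangle_right (g t) (g 0) (f (z + ζ₀ • x))]
    have hb : ∀ t ∈ ball (0 : ℂ) s, ‖dslope g 0 t‖ ≤ 2 / s := fun t ht =>
      Complex.norm_dslope_le_div_of_mapsTo_ball hgd hgm ht
    have hdd : DifferentiableOn ℂ (dslope g 0) (ball 0 s) :=
      (Complex.differentiableOn_dslope (ball_mem_nhds 0 hs)).2 hgd
    have hdm : MapsTo (dslope g 0) (ball 0 s) (closedBall (dslope g 0 0) (4 / s)) := by
      intro t ht
      rw [mem_closedBall_iff_norm]
      calc _ ≤ _ := norm_sub_le _ _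
        _ ≤ 2 / s + 2 / s := add_le_add (hb t ht) (hb 0 (mem_ball_self hs))
        _ = 4 / s := by ring
    have hder : dslope g 0 0 = fderiv ℂ f (z + ζ • x) e := by
      rw [dslope_same]
      have hy : z + ζ • x ∈ E := by
        simpa using (hball (hmem 0 (mem_ball_self hs))).1
      have h1 : HasFDerivAt f (fderiv ℂ f (z + ζ • x)) (z + ζ • x + (0 : ℂ) • e) := by
        simpa using (hf.differentiableAt (hE.mem_nhds hy)).hasFDerivAt
      have h2 : HasDerivAt (fun t : ℂ => z + ζ • x + t • e) e 0 := by
        simpa using ((hasDerivAt_id (0 : ℂ)).smul_const e).const_add (z + ζ • x)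
      exact (h1.comp_hasDerivAt 0 h2).deriv
    have := Complex.dist_le_div_mul_dist_of_mapsTo_ball hdd hdm ht
    rwa [hder, dist_eq_norm, dist_zero_right] at this
  have hunif : TendstoLocallyUniformlyOn
      (fun (t : ℂ) (ζ : ℂ) => dslope (fun t : ℂ => f (z + ζ • x + t • e)) 0 t)
      (fun ζ => fderiv ℂ f (z + ζ • x) e) (𝓝[≠] 0) W := by
    refine TendstoUniformlyOn.tendstoLocallyUniformlyOn ?_
    rw [Metric.tendstoUniformlyOn_iff]
    intro ε hε
    have hlim : Tendsto (fun t : ℂ => (4 / s) / s * ‖t‖) (𝓝[≠] 0) (𝓝 0) := by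
      have : Tendsto (fun t : ℂ => (4 / s) / s * ‖t‖) (𝓝 0) (𝓝 ((4 / s) / s * ‖(0 : ℂ)‖)) :=
        Continuous.tendsto (by fun_prop) 0
      rw [norm_zero, mul_zero] at this
      exact this.mono_left nhdsWithin_le_nhds
    filter_upwards [hlim.eventually (gt_mem_nhds hε),
      mem_nhdsWithin_of_mem_nhds (ball_mem_nhds 0 hs)] with t ht hts ζ hζ
    rw [dist_comm, dist_eq_norm]
    exact (hest ζ hζ t hts).trans_lt ht
  -- For fixed t ≠ 0 the quotient is holomorphic in ζ, so its locally uniform limit is too.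
  have hd : DifferentiableOn ℂ (fun ζ : ℂ => fderiv ℂ f (z + ζ • x) e) W := by
    refine hunif.differentiableOn ?_ hWo
    filter_upwards [mem_nhdsWithin_of_mem_nhds (ball_mem_nhds 0 hs), self_mem_nhdsWithin]
      with t hts ht0
    have hslope : ∀ ζ : ℂ, dslope (fun t : ℂ => f (z + ζ • x + t • e)) 0 t
        = t⁻¹ * (f (z + ζ • x + t • e) - f (z + ζ • x + 0)) := by
      intro ζ
      rw [dslope_of_ne _ ht0, slope_def_module]
      simp
    simp_rw [hslope]
    refine DifferentiableOn.const_mul (DifferentiableOn.sub ?_ ?_) _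
    · exact hf.comp (hdiff _).differentiableOn fun ζ hζ => (hball (hWmem ζ hζ t hts)).1
    · refine hf.comp (hdiff _).differentiableOn fun ζ hζ => ?_
      simpa using (hball (hWmem ζ hζ 0 (mem_ball_self hs))).1
  refine ((hd ζ₀ ?_).differentiableAt (hWo.mem_nhds ?_)).differentiableWithinAt <;>
  exact mem_ball_self (by linarith)

/-- The tangent to log at e passes through the origin; equality holds at y = e. -/
theorem exp_one_mul_log_le {y : ℝ} (hy : 0 ≤ y) : Real.exp 1 * Real.log y ≤ y := by
  rcases hy.eq_or_lt with rfl | hy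
  · simp
  have h := Real.log_le_sub_one_of_pos (div_pos hy (Real.exp_pos 1))
  rw [Real.log_div hy.ne' (Real.exp_pos 1).ne', Real.log_exp] at h
  have h' : Real.log y ≤ y / Real.exp 1 := by linarith
  rwa [le_div_iff₀' (Real.exp_pos 1)] at h'

/-- In Jensen's formula each zero a in the disc contributes its multiplicity times log(1/|a|) ≥ 0.
-/
theorem log_norm_le_circleAverage {g : ℂ → ℂ} (hg : AnalyticOnNhd ℂ g (closedBall 0 1))
    (h0 : g 0 ≠ 0) : Real.log ‖g 0‖ ≤ Real.circleAverage (fun ζ => Real.log ‖g ζ‖) 0 1 := by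
  rw [AnalyticOnNhd.circleAverage_log_norm one_ne_zero (by simpa using hg) h0]
  refine le_add_of_nonneg_left (finsum_nonneg fun a => ?_)
  by_cases ha : a ∈ closedBall (0 : ℂ) |1|
  · refine mul_nonneg ?_ ?_
    · have := (MeromorphicOn.AnalyticOnNhd.divisor_nonneg
        (f := g) (U := closedBall 0 |1|) (by simpa using hg)) a
      exact_mod_cast this
    · rw [one_mul, zero_sub, norm_neg, Real.log_inv, Left.nonneg_neg_iff]
      exact Real.log_nonpos (norm_nonneg _) (by simpa using ha)
  · rw [Function.locallyFinsuppWithin.apply_eq_zero_of_notMem _ ha]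
    simp

/-- Positive powers of the modulus of a holomorphic function have the sub-mean value property. -/
theorem norm_rpow_le_circleAverage {g : ℂ → ℂ} (hg : AnalyticOnNhd ℂ g (closedBall 0 1))
    {p : ℝ} (hp : 0 < p) : ‖g 0‖ ^ p ≤ Real.circleAverage (fun ζ => ‖g ζ‖ ^ p) 0 1 := by
  have hint : ∀ k : ℂ → ℂ, AnalyticOnNhd ℂ k (closedBall 0 1) →
      CircleIntegrable (fun ζ => ‖k ζ‖ ^ p) 0 1 := fun k hk => by
    refine ContinuousOn.circleIntegrable zero_le_one ?_
    exact ((hk.continuousOn.mono sphere_subset_closedBall).norm).rpow_const fun _ _ => Or.inr hp.le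
  rcases eq_or_ne (g 0) 0 with h0 | h0
  · rw [h0, norm_zero, Real.zero_rpow hp.ne']
    exact Real.circleAverage_nonneg_of_nonneg fun _ _ => by positivity
  have hn : 0 < ‖g 0‖ := norm_pos_iff.2 h0
  -- This scaling makes |s g(0)|^p = e, the equality case of e log y ≤ y, so nothing is lost at the
  -- centre when logarithms are replaced by powers.
  set s : ℝ := Real.exp (1 / p) / ‖g 0‖ with hs
  have hs0 : 0 < s := by positivity
  set k : ℂ → ℂ := fun ζ => s * g ζ with hk
  have hka : AnalyticOnNhd ℂ k (closedBall 0 1) := analyticOnNhd_const.mul hg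
  have hk0 : ‖k 0‖ = Real.exp (1 / p) := by
    rw [hk, norm_mul, Complex.norm_real, Real.norm_of_nonneg hs0.le, hs,
      div_mul_cancel₀ _ hn.ne']
  have hkp : ∀ ζ, ‖k ζ‖ ^ p = s ^ p * ‖g ζ‖ ^ p := fun ζ => by
    rw [hk, norm_mul, Complex.norm_real, Real.norm_of_nonneg hs0.le,
      Real.mul_rpow hs0.le (norm_nonneg _)]
  have hlog := log_norm_le_circleAverage hka (by rw [← norm_pos_iff, hk0]; positivity)
  rw [hk0, Real.log_exp] at hlog
  have hmero : MeromorphicOn k (sphere 0 |1|) := fun ζ hζ =>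
    (hka ζ (sphere_subset_closedBall (by simpa using hζ))).meromorphicAt
  have hkey : ‖k 0‖ ^ p ≤ Real.circleAverage (fun ζ => ‖k ζ‖ ^ p) 0 1 := by
    calc ‖k 0‖ ^ p = Real.exp 1 * p * (1 / p) := by
          rw [hk0, ← Real.exp_mul, one_div, inv_mul_cancel₀ hp.ne', mul_assoc,
            mul_inv_cancel₀ hp.ne', mul_one]
      _ ≤ Real.exp 1 * p * Real.circleAverage (fun ζ => Real.log ‖k ζ‖) 0 1 := by gcongr
      _ = Real.circleAverage (fun ζ => (Real.exp 1 * p) • Real.log ‖k ζ‖) 0 1 := by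
          rw [Real.circleAverage_fun_smul, smul_eq_mul]
      _ ≤ _ := by
          refine Real.circleAverage_mono
            (hmero.circleIntegrable_log_norm.const_fun_smul) (hint k hka) fun ζ _ => ?_
          have := exp_one_mul_log_le (Real.rpow_nonneg (norm_nonneg (k ζ)) p)
          rcases (norm_nonneg (k ζ)).eq_or_lt with h | h
          · simp [← h, Real.zero_rpow hp.ne']
          · rw [Real.log_rpow h] at this
            simpa [mul_assoc] using this
  simp_rw [hkp, ← smul_eq_mul (s ^ p)] at hkey
  rw [Real.circleAverage_fun_smul, smul_eq_mul, smul_eq_mul] at hkey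
  exact le_of_mul_le_mul_left hkey (by positivity)

end ComplexAnalysis

/-! ### Norms of complex derivatives and real gradients. -/

section Gradient

variable {n : ℕ}

theorem CSpace.norm_clm_sq (L : CSpace n →L[ℂ] ℂ) :
    ‖L‖ ^ 2 = ∑ j, ‖L (EuclideanSpace.single j (1 : ℂ))‖ ^ 2 := by
  obtain ⟨w, rfl⟩ := (InnerProductSpace.toDual ℂ (CSpace n)).surjective L
  rw [LinearIsometryEquiv.norm_map, EuclideanSpace.norm_sq_eq]
  refine Finset.sum_congr rfl fun j _ => ?_
  simp [InnerProductSpace.toDual_apply_apply, EuclideanSpace.inner_single_right]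

/-- By Riesz representation the norm is attained at the normalised representing vector. This
supplies a fixed direction that sees the full norm of f'(z). -/
theorem CSpace.exists_norm_clm_apply_eq (L : CSpace n →L[ℂ] ℂ) :
    ∃ e : CSpace n, ‖e‖ ≤ 1 ∧ ‖L e‖ = ‖L‖ := by
  obtain ⟨w, rfl⟩ := (InnerProductSpace.toDual ℂ (CSpace n)).surjective L
  rw [LinearIsometryEquiv.norm_map]
  rcases eq_or_ne w 0 with rfl | hw
  · exact ⟨0, by simp⟩
  have hw' : ‖w‖ ≠ 0 := norm_ne_zero_iff.2 hw
  refine ⟨(‖w‖⁻¹ : ℂ) • w, ?_, ?_⟩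
  · rw [norm_smul, norm_inv, Complex.norm_real, norm_norm, inv_mul_cancel₀ hw']
  · rw [map_smul, InnerProductSpace.toDual_apply_apply, inner_self_eq_norm_sq_to_K, norm_smul,
      norm_inv, norm_pow, Complex.norm_real, norm_norm]
    simp only [Complex.coe_algebraMap, Complex.norm_real, norm_norm]
    field_simp

theorem norm_realGrad_sq (u : CSpace n → ℝ) (z : CSpace n) :
    ‖realGrad u z‖ ^ 2 = ∑ j, ((fderiv ℝ u z (EuclideanSpace.single j (1 : ℂ))) ^ 2 +
      (fderiv ℝ u z (EuclideanSpace.single j Complex.I)) ^ 2) := by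
  rw [EuclideanSpace.norm_sq_eq, Fintype.sum_sum_type, ← Finset.sum_add_distrib]
  simp [realGrad]

/-- By the Cauchy–Riemann equations, the gradient of `Re (c f)`, `|c| = 1`, has the norm of the
complex derivative of `f`. -/
theorem norm_realGrad_eq_norm_fderiv {u : CSpace n → ℝ} {f : CSpace n → ℂ} {z : CSpace n} {c : ℂ}
    (hc : ‖c‖ = 1) (hf : DifferentiableAt ℂ f z) (hu : u =ᶠ[𝓝 z] fun w => (c * f w).re) :
    ‖realGrad u z‖ = ‖fderiv ℂ f z‖ := by
  have hd : HasFDerivAt u (Complex.reCLM ∘L (c • fderiv ℂ f z).restrictScalars ℝ) z := by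
    refine HasFDerivAt.congr_of_eventuallyEq ?_ hu
    exact Complex.reCLM.hasFDerivAt.comp z ((hf.hasFDerivAt.const_mul c).restrictScalars ℝ)
  have hI : ∀ j, EuclideanSpace.single j Complex.I
      = Complex.I • (EuclideanSpace.single j (1 : ℂ) : CSpace n) := fun j => by
    ext i
    by_cases h : i = j <;> simp [h]
  rw [← sq_eq_sq₀ (norm_nonneg _) (norm_nonneg _), norm_realGrad_sq, CSpace.norm_clm_sq,
    hd.fderiv]
  refine Finset.sum_congr rfl fun j _ => ?_
  rw [hI]
  set a := fderiv ℂ f z (EuclideanSpace.single j (1 : ℂ)) with ha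
  have h1 : ‖a‖ ^ 2 = ‖c * a‖ ^ 2 := by rw [norm_mul, hc, one_mul]
  rw [h1, ← Complex.normSq_eq_norm_sq, Complex.normSq_apply]
  have h2 : (Complex.reCLM ∘L (c • fderiv ℂ f z).restrictScalars ℝ)
      (EuclideanSpace.single j (1 : ℂ)) = (c * a).re := rfl
  -- Complex linearity turns the y-derivative into Re(i c a) = -Im(c a), so the two squares add up
  -- to |c a|².
  have h3 : (Complex.reCLM ∘L (c • fderiv ℂ f z).restrictScalars ℝ)
      (Complex.I • (EuclideanSpace.single j (1 : ℂ) : CSpace n)) = -(c * a).im := by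
    change (c * fderiv ℂ f z (Complex.I • (EuclideanSpace.single j (1 : ℂ)))).re = _
    rw [map_smul, smul_eq_mul, ← ha]
    simp only [Complex.mul_re, Complex.mul_im, Complex.I_re, Complex.I_im]
    ring
  rw [h2, h3]
  ring

end Gradient

/-! ### Sub-mean value property of |f'|^p on balls. -/

section MeanValue

open MeasureTheory

variable {n : ℕ}

/-- Multiplication by a unimodular scalar is a real-linear isometry, so it preserves volume and the
ball. -/
theorem setIntegral_ball_rotate (h : CSpace n → ℝ) (R : ℝ) {c : ℂ} (hc : ‖c‖ = 1) :
    ∫ x in ball (0 : CSpace n) R, h (c • x) = ∫ x in ball (0 : CSpace n) R, h x := by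
  set e : CSpace n ≃ₗᵢ[ℝ] CSpace n :=
    { (LinearEquiv.smulOfUnit (M := CSpace n)
        (Units.mk0 c (norm_ne_zero_iff.1 (by rw [hc]; exact one_ne_zero)))).restrictScalars ℝ with
      norm_map' := fun x => by
        change ‖c • x‖ = ‖x‖
        rw [norm_smul, hc, one_mul] } with he
  have hex : ∀ x, e x = c • x := fun x => rfl
  have hpre : e ⁻¹' ball 0 R = ball 0 R := by
    ext x
    simp
  have := e.measurePreserving.setIntegral_preimage_emb
    e.toHomeomorph.measurableEmbedding h (ball 0 R)
  rw [hpre] at this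
  exact this

/-- Integrating the sub-mean value inequality on the circles `ζ ↦ ζ • x` over a ball. -/
theorem mul_volume_ball_le_setIntegral {h : CSpace n → ℝ} (hm : Measurable h) {R M a : ℝ}
    (hM : ∀ x ∈ ball (0 : CSpace n) R, ‖h x‖ ≤ M)
    (ha : ∀ x ∈ ball (0 : CSpace n) R, a ≤ Real.circleAverage (fun ζ => h (ζ • x)) 0 1) :
    a * volume.real (ball (0 : CSpace n) R) ≤ ∫ x in ball (0 : CSpace n) R, h x := by
  have : IsFiniteMeasure (volume.restrict (ball (0 : CSpace n) R)) :=
    ⟨by simpa using measure_ball_lt_top⟩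
  have hcirc : ∀ θ : ℝ, ‖circleMap 0 1 θ‖ = 1 := fun θ => by simp
  have hint : Integrable (Function.uncurry fun (x : CSpace n) (θ : ℝ) => h (circleMap 0 1 θ • x))
      ((volume.restrict (ball (0 : CSpace n) R)).prod (volume.restrict (Ioc 0 (2 * Real.pi)))) := by
    refine Integrable.of_bound (C := M) ?_ ?_
    · refine (hm.comp ?_).aestronglyMeasurable
      have : Continuous fun q : CSpace n × ℝ => circleMap 0 1 q.2 • q.1 := by fun_prop
      exact this.measurable
    · rw [Measure.prod_restrict]
      refine ae_restrict_of_forall_mem (measurableSet_ball.prod measurableSet_Ioc) ?_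
      rintro ⟨x, θ⟩ ⟨hx, -⟩
      refine hM _ ?_
      rw [mem_ball_zero_iff, norm_smul, hcirc, one_mul]
      simpa using hx
  have havg : ∀ x : CSpace n, Real.circleAverage (fun ζ => h (ζ • x)) 0 1
      = (2 * Real.pi)⁻¹ * ∫ θ in Ioc 0 (2 * Real.pi), h (circleMap 0 1 θ • x) := fun x => by
    rw [Real.circleAverage_def, intervalIntegral.integral_of_le Real.two_pi_pos.le, smul_eq_mul]
  have hint' : IntegrableOn (fun x : CSpace n => Real.circleAverage (fun ζ => h (ζ • x)) 0 1)
      (ball 0 R) := by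
    simp_rw [havg]
    exact hint.integral_prod_left.const_mul _
  calc a * volume.real (ball (0 : CSpace n) R) = ∫ _ in ball (0 : CSpace n) R, a := by
        rw [setIntegral_const, smul_eq_mul, mul_comm]
    _ ≤ ∫ x in ball (0 : CSpace n) R, Real.circleAverage (fun ζ => h (ζ • x)) 0 1 :=
        setIntegral_mono_on (integrable_const a) hint' measurableSet_ball ha
    _ = (2 * Real.pi)⁻¹ * ∫ x in ball (0 : CSpace n) R,
          ∫ θ in Ioc 0 (2 * Real.pi), h (circleMap 0 1 θ • x) := by
        simp_rw [havg]
        rw [integral_const_mul]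
    -- After Fubini the inner integral is independent of θ by rotation invariance.
    _ = (2 * Real.pi)⁻¹ * ∫ θ in Ioc 0 (2 * Real.pi),
          ∫ x in ball (0 : CSpace n) R, h (circleMap 0 1 θ • x) := by
        rw [integral_integral_swap hint]
    _ = ∫ x in ball (0 : CSpace n) R, h x := by
        simp_rw [setIntegral_ball_rotate h R (hcirc _)]
        rw [setIntegral_const, smul_eq_mul, Real.volume_real_Ioc_of_le Real.two_pi_pos.le,
          sub_zero, inv_mul_cancel_left₀ Real.two_pi_pos.ne']

/-- Every holomorphic function has bounded derivative on balls that are relatively compact in its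
domain. -/
theorem exists_norm_fderiv_le {f : CSpace n → ℂ} {z : CSpace n} {R : ℝ} (hR : 0 < R)
    (hf : DifferentiableOn ℂ f (ball z (2 * R))) :
    ∃ M, ∀ w ∈ ball z R, ‖fderiv ℂ f w‖ ≤ M := by
  -- The radius 3R/2 keeps the closed ball inside the domain and leaves room for balls of radius R/2
  -- about each w.
  obtain ⟨M, hM⟩ := (isCompact_closedBall z (3 / 2 * R)).exists_bound_of_continuousOn
    (hf.continuousOn.mono (closedBall_subset_ball (by linarith)))
  refine ⟨(M + M) / (R / 2), fun w hw => ?_⟩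
  have hsub : ball w (R / 2) ⊆ closedBall z (3 / 2 * R) := by
    intro y hy
    rw [mem_ball] at hw hy
    rw [mem_closedBall]
    linarith [dist_triangle y w z]
  refine Complex.norm_fderiv_le_div_of_mapsTo_ball
    (hf.mono (hsub.trans (closedBall_subset_ball (by linarith)))) (fun y hy => ?_) (by linarith)
  rw [mem_closedBall_iff_norm]
  exact (norm_sub_le _ _).trans
    (add_le_add (hM y (hsub hy)) (hM w (hsub (mem_ball_self (by linarith)))))

/-- Freeze a direction e in which f'(z) attains its norm: f'(z + ζx)e is a scalar holomorphic
function of ζ, of modulus |f'(z)| at ζ = 0 and at most |f'(z + ζx)| elsewhere. -/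
theorem norm_fderiv_rpow_le_circleAverage {f : CSpace n → ℂ} {z x : CSpace n} {R p : ℝ}
    (hp : 0 < p) (hR : 0 < R) (hf : DifferentiableOn ℂ f (ball z (2 * R)))
    (hx : x ∈ ball (0 : CSpace n) R) :
    ‖fderiv ℂ f z‖ ^ p ≤ Real.circleAverage (fun ζ => ‖fderiv ℂ f (z + ζ • x)‖ ^ p) 0 1 := by
  obtain ⟨e, he, heq⟩ := CSpace.exists_norm_clm_apply_eq (fderiv ℂ f z)
  obtain ⟨M, hM⟩ := exists_norm_fderiv_le hR hf
  have hmem : ∀ ζ ∈ closedBall (0 : ℂ) 1, z + ζ • x ∈ ball z R := by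
    intro ζ hζ
    rw [mem_closedBall_zero_iff] at hζ
    rw [mem_ball_zero_iff] at hx
    rw [mem_ball_iff_norm, add_sub_cancel_left, norm_smul]
    nlinarith [norm_nonneg x]
  set g : ℂ → ℂ := fun ζ => fderiv ℂ f (z + ζ • x) e with hg
  have hU : IsOpen ((fun ζ : ℂ => z + ζ • x) ⁻¹' ball z (2 * R)) :=
    isOpen_ball.preimage (by fun_prop)
  have hga : AnalyticOnNhd ℂ g (closedBall 0 1) :=
    ((differentiableOn_fderiv_apply_line isOpen_ball hf z x e).analyticOnNhd hU).mono
      fun ζ hζ => ball_subset_ball (by linarith) (hmem ζ hζ)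
  have hgle : ∀ ζ, ‖g ζ‖ ≤ ‖fderiv ℂ f (z + ζ • x)‖ := fun ζ =>
    ((fderiv ℂ f (z + ζ • x)).le_opNorm e).trans
      (mul_le_of_le_one_right (norm_nonneg _) he)
  have hg0 : ‖g 0‖ = ‖fderiv ℂ f z‖ := by simp [hg, heq]
  rw [← hg0]
  refine (norm_rpow_le_circleAverage hga hp).trans (Real.circleAverage_mono ?_ ?_ ?_)
  · refine ContinuousOn.circleIntegrable zero_le_one ?_
    exact ((hga.continuousOn.mono sphere_subset_closedBall).norm).rpow_const
      fun _ _ => Or.inr hp.le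
  -- Integrability needs only measurability and the bound M, not continuity of the derivative.
  · have hmeas : Measurable fun θ : ℝ => ‖fderiv ℂ f (z + circleMap 0 1 θ • x)‖ ^ p := by
      have hc : Continuous fun θ : ℝ => z + circleMap 0 1 θ • x := by fun_prop
      exact (((measurable_fderiv ℂ f).comp hc.measurable).norm).pow_const p
    rw [CircleIntegrable, intervalIntegrable_iff]
    refine Measure.integrableOn_of_bounded (M := M ^ p)
      (by simp [ENNReal.mul_eq_top]) hmeas.aestronglyMeasurable
      (ae_of_all _ fun θ => ?_)
    rw [Real.norm_of_nonneg (by positivity)]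
    exact Real.rpow_le_rpow (norm_nonneg _) (hM _ (hmem _ (by simp))) hp.le
  · exact fun ζ _ => Real.rpow_le_rpow (norm_nonneg _) (hgle ζ) hp.le

/-- Positive powers of the norm of the derivative of a holomorphic function have the sub-mean
value property on balls. -/
theorem norm_fderiv_rpow_mul_volume_le {f : CSpace n → ℂ} {z : CSpace n} {R p : ℝ}
    (hp : 0 < p) (hR : 0 < R) (hf : DifferentiableOn ℂ f (ball z (2 * R))) :
    ‖fderiv ℂ f z‖ ^ p * volume.real (ball z R) ≤ ∫ w in ball z R, ‖fderiv ℂ f w‖ ^ p := by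
  obtain ⟨M, hM⟩ := exists_norm_fderiv_le hR hf
  have hpre : (fun x => z + x) ⁻¹' ball z R = ball 0 R := by
    ext x
    simp
  have hmp : MeasurePreserving (fun x : CSpace n => z + x) := measurePreserving_add_left volume z
  have hvol : volume.real (ball z R) = volume.real (ball (0 : CSpace n) R) := by
    rw [measureReal_def, measureReal_def, ← hpre,
      hmp.measure_preimage measurableSet_ball.nullMeasurableSet]
  have hint := hmp.setIntegral_preimage_emb (Homeomorph.addLeft z).measurableEmbedding
    (fun w => ‖fderiv ℂ f w‖ ^ p) (ball z R)
  rw [hpre] at hint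
  rw [hvol, ← hint]
  refine mul_volume_ball_le_setIntegral (M := M ^ p) ?_ (fun x hx => ?_)
    fun x hx => norm_fderiv_rpow_le_circleAverage hp hR hf hx
  · exact (((measurable_fderiv ℂ f).comp (measurable_const_add z)).norm).pow_const p
  · rw [Real.norm_of_nonneg (by positivity)]
    refine Real.rpow_le_rpow (norm_nonneg _) (hM _ ?_) hp.le
    rwa [← hpre] at hx

end MeanValue

/-! ### Elementary properties of majorants. -/

theorem IsMajorant.nonneg {ψ : ℝ → ℝ} (hψ : IsMajorant ψ) {t : ℝ} (ht : 0 ≤ t) : 0 ≤ ψ t := by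
  rw [← hψ.map_zero]
  exact hψ.monotoneOn (mem_Ici.2 le_rfl) ht ht

theorem IsMajorant.div_le_div {ψ : ℝ → ℝ} (hψ : IsMajorant ψ) {s t : ℝ} (hs : 0 < s)
    (hst : s ≤ t) : ψ t / t ≤ ψ s / s :=
  hψ.antitoneOn_div hs (hs.trans_le hst) hst

theorem IsMajorant.le_two_mul {ψ : ℝ → ℝ} (hψ : IsMajorant ψ) {s t : ℝ} (ht : 0 < t)
    (hs : 0 ≤ s) (hst : s ≤ 2 * t) : ψ s ≤ 2 * ψ t := by
  have h := hψ.div_le_div ht (by linarith : t ≤ 2 * t)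
  rw [div_le_div_iff₀ (by linarith) ht] at h
  calc ψ s ≤ ψ (2 * t) := hψ.monotoneOn hs (by simp; linarith) hst
    _ ≤ 2 * ψ t := le_of_mul_le_mul_right (by linarith) ht

theorem IsMajorant.tendsto_zero {ψ : ℝ → ℝ} (hψ : IsMajorant ψ) :
    Tendsto ψ (𝓝[≥] 0) (𝓝 0) := by
  have := hψ.continuousOn 0 (mem_Ici.2 le_rfl)
  rwa [ContinuousWithinAt, hψ.map_zero] at this

/-! ### Distance to the boundary. -/

section BoundaryDistance

variable {n : ℕ} {E : Set (CSpace n)}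

theorem nonempty_frontier_of_proper (hne : E.Nonempty) (hu : E ≠ univ) : (frontier E).Nonempty :=
  nonempty_frontier_iff.2 ⟨hne, hu⟩

theorem bdryDist_pos (hE : IsOpen E) (hu : E ≠ univ) {z : CSpace n} (hz : z ∈ E) :
    0 < bdryDist E z := by
  refine (isClosed_frontier.notMem_iff_infDist_pos (nonempty_frontier_of_proper ⟨z, hz⟩ hu)).1 ?_
  rw [hE.frontier_eq]
  exact fun h => h.2 hz

theorem bdryDist_le_add (z w : CSpace n) : bdryDist E z ≤ bdryDist E w + dist z w :=
  infDist_le_infDist_add_dist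

/-- The ball misses the frontier, so the disjoint open sets E and the exterior cover it; being
connected and meeting E, it lies in E. -/
theorem ball_bdryDist_subset (hE : IsOpen E) (hu : E ≠ univ) {z : CSpace n} (hz : z ∈ E) :
    ball z (bdryDist E z) ⊆ E := by
  refine IsPreconnected.subset_left_of_subset_union (v := (closure E)ᶜ) hE
    isClosed_closure.isOpen_compl (disjoint_compl_right.mono_left subset_closure) ?_
    ⟨z, mem_ball_self (bdryDist_pos hE hu hz), hz⟩ (convex_ball _ _).isPreconnected
  intro w hw
  by_contra hcon
  rw [mem_union, not_or, mem_compl_iff, not_not] at hcon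
  have hfr : w ∈ frontier E := by
    rw [hE.frontier_eq]
    exact ⟨hcon.2, hcon.1⟩
  rw [mem_ball, dist_comm] at hw
  exact (infDist_le_dist_of_mem hfr).not_gt hw

end BoundaryDistance

/-! ### Lipschitz classes and the derivative bound. -/

section Lipschitz

variable {n : ℕ} {ψ : ℝ → ℝ} {E : Set (CSpace n)} {f : CSpace n → ℂ}

/-- The analogue of `GradBound` for the complex derivative of a holomorphic function. -/
def DerivBound (ψ : ℝ → ℝ) (E : Set (CSpace n)) (f : CSpace n → ℂ) : Prop :=
  ∃ C > 0, ∀ z ∈ E, ‖fderiv ℂ f z‖ ≤ C * (ψ (bdryDist E z) / bdryDist E z)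

/-- For y in the half ball, d(y) ≥ d(z)/2 > |z - w|. As ψ(t)/t is non-increasing, |f'(y)| ≤ Cψ(|z -
w|)/|z - w|, and the mean value inequality applies on the convex ball. -/
theorem DerivBound.memLocLip (hψ : IsMajorant ψ) (hE : IsOpen E) (hu : E ≠ univ)
    (hf : DifferentiableOn ℂ f E) (h : DerivBound ψ E f) : MemLocLip ψ E f := by
  obtain ⟨C, hC, hb⟩ := h
  refine ⟨C, hC, fun z hz w hw => ?_⟩
  rcases eq_or_ne z w with rfl | hne
  · simp [hψ.map_zero]
  have hzw : 0 < ‖z - w‖ := norm_pos_iff.2 (sub_ne_zero.2 hne)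
  have hsub : ball z (bdryDist E z / 2) ⊆ E :=
    (ball_subset_ball (by linarith [bdryDist_pos hE hu hz])).trans (ball_bdryDist_subset hE hu hz)
  have hmv := Convex.norm_image_sub_le_of_norm_fderiv_le (𝕜 := ℂ) (f := f)
    (C := C * (ψ ‖z - w‖ / ‖z - w‖)) (s := ball z (bdryDist E z / 2)) (x := w) (y := z)
    (fun y hy => hf.differentiableAt (hE.mem_nhds (hsub hy)))
    (fun y hy => (hb y (hsub hy)).trans ?_) (convex_ball _ _)
    (by rwa [mem_ball_iff_norm, norm_sub_rev]) (mem_ball_self (by linarith))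
  · rwa [mul_assoc, div_mul_cancel₀ _ hzw.ne'] at hmv
  · refine mul_le_mul_of_nonneg_left (hψ.div_le_div hzw ?_) hC.le
    have := bdryDist_le_add (E := E) z y
    rw [mem_ball, dist_comm] at hy
    linarith

theorem DerivBound.of_oscillation {C : ℝ} (hC : 0 < C)
    (h : ∀ z ∈ E, ‖fderiv ℂ f z‖ ≤ 4 * (C * ψ (bdryDist E z)) / bdryDist E z) :
    DerivBound ψ E f :=
  ⟨4 * C, by positivity, fun z hz => (h z hz).trans_eq (by ring)⟩

theorem MemLip.le_add {g : CSpace n → ℝ} (hψ : IsMajorant ψ) (hE : IsOpen E) (hu : E ≠ univ)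
    (h : MemLip ψ E g) :
    ∃ C > 0, ∀ z ∈ E, ∀ w ∈ ball z (bdryDist E z), g w ≤ g z + C * ψ (bdryDist E z) := by
  obtain ⟨C, hC, hb⟩ := h
  refine ⟨C, hC, fun z hz w hw => ?_⟩
  have h1 := hb w (ball_bdryDist_subset hE hu hz hw) z hz
  have h2 : ψ ‖w - z‖ ≤ ψ (bdryDist E z) :=
    hψ.monotoneOn (norm_nonneg _) (bdryDist_pos hE hu hz).le (mem_ball_iff_norm.1 hw).le
  have h3 := mul_le_mul_of_nonneg_left h2 hC.le
  have h4 := (le_abs_self _).trans_eq (Real.norm_eq_abs (g w - g z)).symm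
  linarith

theorem DerivBound.of_memLip_norm (hψ : IsMajorant ψ) (hE : IsOpen E) (hu : E ≠ univ)
    (hf : DifferentiableOn ℂ f E) (h : MemLip ψ E fun z => ‖f z‖) : DerivBound ψ E f := by
  obtain ⟨C, hC, hb⟩ := h.le_add hψ hE hu
  exact .of_oscillation hC fun z hz => norm_fderiv_le_of_norm_le (bdryDist_pos hE hu hz)
    (hf.mono (ball_bdryDist_subset hE hu hz)) (hb z hz)

theorem DerivBound.of_memLip_abs (hψ : IsMajorant ψ) (hE : IsOpen E) (hu : E ≠ univ)
    (hf : DifferentiableOn ℂ f E) {u : CSpace n → ℝ} {c : ℂ} (hc : ‖c‖ = 1)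
    (huf : ∀ z ∈ E, u z = (c * f z).re) (h : MemLip ψ E fun z => |u z|) : DerivBound ψ E f := by
  obtain ⟨C, hC, hb⟩ := h.le_add hψ hE hu
  refine .of_oscillation hC fun z hz => norm_fderiv_le_of_abs_re_mul_le hc
    (bdryDist_pos hE hu hz) (hf.mono (ball_bdryDist_subset hE hu hz)) fun w hw => ?_
  rw [← huf z hz, ← huf w (ball_bdryDist_subset hE hu hz hw)]
  exact hb z hz w hw

/-- The values at z and w are compared through a boundary point y nearest to z, for which |w - y| <
2d(z). -/
theorem DerivBound.of_memLipBdry_norm (hψ : IsMajorant ψ) (hE : IsOpen E) (hu : E ≠ univ)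
    (hf : DifferentiableOn ℂ f E) (h : MemLipBdry ψ E fun z => ‖f z‖) : DerivBound ψ E f := by
  obtain ⟨g, hg, -, C, hC, hb⟩ := h
  -- 3 = 1 + 2: Cψ(d) between z and y, and Cψ(2d) ≤ 2Cψ(d) between y and w.
  refine .of_oscillation (C := 3 * C) (by positivity) fun z hz => ?_
  have hd := bdryDist_pos hE hu hz
  have hsub := ball_bdryDist_subset hE hu hz
  refine norm_fderiv_le_of_norm_le hd (hf.mono hsub) fun w hw => ?_
  obtain ⟨y, hy, hzy⟩ := isClosed_frontier.exists_infDist_eq_dist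
    (nonempty_frontier_of_proper ⟨z, hz⟩ hu) z
  change bdryDist E z = dist z y at hzy
  have h1 := hb z hz y hy
  have h2 := hb w (hsub hw) y hy
  rw [hg hz, Real.norm_eq_abs, ← dist_eq_norm, ← hzy] at h1
  rw [hg (hsub hw), Real.norm_eq_abs, ← dist_eq_norm] at h2
  have h3 : ψ (dist w y) ≤ 2 * ψ (bdryDist E z) := by
    refine hψ.le_two_mul hd dist_nonneg ?_
    rw [mem_ball] at hw
    linarith [dist_triangle w z y]
  have h4 := mul_le_mul_of_nonneg_left h3 hC.le
  have h5 := neg_le_of_abs_le h1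
  have h6 := le_of_abs_le h2
  linarith

/-- A function of class `𝓛_ψ(E)` extends continuously to the boundary, in class `𝓛_ψ(E, ∂E)`. -/
theorem MemLip.memLipBdry {F : Type*} [NormedAddCommGroup F] [CompleteSpace F]
    (hψ : IsMajorant ψ) {g : CSpace n → F} (h : MemLip ψ E g) : MemLipBdry ψ E g := by
  obtain ⟨C, hC, hb⟩ := h
  have hlim : Tendsto (fun t => C * ψ t) (𝓝[≥] 0) (𝓝 0) := by
    simpa using hψ.tendsto_zero.const_mul C
  have huc : UniformContinuousOn g E := by
    rw [Metric.uniformContinuousOn_iff]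
    intro ε hε
    have hev := hlim.eventually (gt_mem_nhds hε)
    obtain ⟨δ, hδ, hδε⟩ := Metric.mem_nhdsWithin_iff.1 hev
    refine ⟨δ, hδ, fun x hx y hy hxy => ?_⟩
    rw [dist_eq_norm]
    refine (hb x hx y hy).trans_lt (hδε ⟨?_, norm_nonneg _⟩)
    rwa [mem_ball_zero_iff, norm_norm, ← dist_eq_norm]
  -- Uniform continuity sends the Cauchy filter 𝓝[E] x to a Cauchy filter, which converges by
  -- completeness.
  have hex : ∀ x ∈ closure E, ∃ y, Tendsto g (𝓝[E] x) (𝓝 y) := by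
    intro x hx
    have : (𝓝[E] x).NeBot := mem_closure_iff_nhdsWithin_neBot.1 hx
    have hcau : Cauchy (𝓝[E] x) := cauchy_nhds.mono nhdsWithin_le_nhds
    have hcau' : Cauchy (map g (𝓝[E] x)) :=
      hcau.map_of_le huc (le_principal_iff.2 self_mem_nhdsWithin)
    exact CompleteSpace.complete hcau'
  have hgE : EqOn (extendFrom E g) g E := fun x hx => by
    refine extendFrom_eq (subset_closure hx) ?_
    exact huc.continuousOn x hx
  have hcont : ContinuousOn (extendFrom E g) (closure E) := continuousOn_extendFrom subset_rfl hex
  refine ⟨extendFrom E g, hgE, hcont.mono ?_, C, hC, fun z hz w hw => ?_⟩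
  · exact union_subset subset_closure frontier_subset_closure
  · have hwc : w ∈ closure E := frontier_subset_closure hw
    have : (𝓝[E] w).NeBot := mem_closure_iff_nhdsWithin_neBot.1 hwc
    rw [hgE hz]
    have hl : Tendsto (fun y => ‖g z - g y‖) (𝓝[E] w) (𝓝 ‖g z - extendFrom E g w‖) :=
      (tendsto_const_nhds.sub (tendsto_extendFrom (hex w hwc))).norm
    have hr : Tendsto (fun y => C * ψ ‖z - y‖) (𝓝[E] w) (𝓝 (C * ψ ‖z - w‖)) := by
      refine Tendsto.const_mul C ((hψ.continuousOn ‖z - w‖ (norm_nonneg _)).tendsto.comp ?_)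
      refine tendsto_nhdsWithin_iff.2 ⟨?_, Eventually.of_forall fun y => norm_nonneg _⟩
      exact (Continuous.tendsto (by fun_prop) w).mono_left nhdsWithin_le_nhds
    exact le_of_tendsto_of_tendsto hl hr
      (eventually_nhdsWithin_of_forall fun y hy => hb z hz y hy)

end Lipschitz

/-! ### Pointwise and averaged gradient bounds. -/

section GradientMeans

open MeasureTheory

variable {n : ℕ} {ψ : ℝ → ℝ} {E : Set (CSpace n)} {f : CSpace n → ℂ} {u : CSpace n → ℝ}

theorem gradBound_iff_derivBound (hgrad : ∀ z ∈ E, ‖realGrad u z‖ = ‖fderiv ℂ f z‖) :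
    GradBound ψ E u ↔ DerivBound ψ E f := by
  refine exists_congr fun C => and_congr_right fun _ => forall₂_congr fun z hz => ?_
  rw [hgrad z hz]

/-- The mean dominates the value at the centre by the sub-mean value property. Conversely, distances
to the boundary on the half ball are at least d(z)/2, so the pointwise bound there is uniform. -/
theorem gradMeanBound_iff_derivBound (hψ : IsMajorant ψ) (hE : IsOpen E) (hu : E ≠ univ)
    (hf : DifferentiableOn ℂ f E) {p : ℝ} (hp : 0 < p)
    (hgrad : ∀ z ∈ E, ‖realGrad u z‖ = ‖fderiv ℂ f z‖) :
    GradMeanBound ψ E u p ↔ DerivBound ψ E f := by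
  have hsub : ∀ z ∈ E, ball z (bdryDist E z / 2) ⊆ E := fun z hz =>
    (ball_subset_ball (by linarith [bdryDist_pos hE hu hz])).trans (ball_bdryDist_subset hE hu hz)
  have hvol : ∀ z ∈ E, 0 < volume.real (ball z (bdryDist E z / 2)) := fun z hz =>
    ENNReal.toReal_pos (measure_ball_pos volume z (half_pos (bdryDist_pos hE hu hz))).ne'
      measure_ball_lt_top.ne
  have hmean : ∀ z ∈ E, gradMean E u p z = volume.real (ball z (bdryDist E z / 2)) ^ (-(1 / p)) *
      (∫ w in ball z (bdryDist E z / 2), ‖fderiv ℂ f w‖ ^ p) ^ (1 / p) := fun z hz => by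
    rw [gradMean]
    congr 2
    exact setIntegral_congr_fun measurableSet_ball fun w hw => by
      simp only [hgrad w (hsub z hz hw)]
  -- The p-mean of a constant is that constant; both directions compare with it.
  have hconst : ∀ {a m : ℝ}, 0 ≤ a → 0 < m → m ^ (-(1 / p)) * (a ^ p * m) ^ (1 / p) = a := by
    intro a m ha hm
    rw [Real.mul_rpow (Real.rpow_nonneg ha p) hm.le, ← Real.rpow_mul ha, mul_one_div_cancel hp.ne',
      Real.rpow_one, mul_left_comm, ← Real.rpow_add hm, neg_add_cancel, Real.rpow_zero, mul_one]
  constructor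
  · rintro ⟨C, hC, hb⟩
    refine ⟨C, hC, fun z hz => le_trans ?_ (hb z hz)⟩
    have hd := bdryDist_pos hE hu hz
    rw [hmean z hz]
    refine (hconst (norm_nonneg (fderiv ℂ f z)) (hvol z hz)).symm.trans_le ?_
    have hsm := norm_fderiv_rpow_mul_volume_le hp (half_pos hd)
      (hf.mono (by rw [mul_div_cancel₀ _ two_ne_zero]; exact ball_bdryDist_subset hE hu hz))
    gcongr
  · rintro ⟨C, hC, hb⟩
    -- The 2 comes from ψ(d/2)/(d/2) ≤ 2ψ(d)/d, as ψ is monotone.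
    refine ⟨C * 2, by positivity, fun z hz => ?_⟩
    have hd := bdryDist_pos hE hu hz
    set K := C * 2 * (ψ (bdryDist E z) / bdryDist E z) with hK
    have hK0 : 0 ≤ K := by
      have := hψ.nonneg hd.le
      positivity
    have hle : ∀ w ∈ ball z (bdryDist E z / 2), ‖fderiv ℂ f w‖ ≤ K := by
      intro w hw
      refine (hb w (hsub z hz hw)).trans ?_
      rw [hK, mul_assoc]
      refine mul_le_mul_of_nonneg_left ?_ hC.le
      have h1 := bdryDist_le_add (E := E) z w
      rw [mem_ball, dist_comm] at hw
      calc ψ (bdryDist E w) / bdryDist E w ≤ ψ (bdryDist E z / 2) / (bdryDist E z / 2) :=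
            hψ.div_le_div (half_pos hd) (by linarith)
        _ ≤ ψ (bdryDist E z) / (bdryDist E z / 2) := by
            have := hψ.monotoneOn (half_pos hd).le hd.le (by linarith)
            gcongr
        _ = 2 * (ψ (bdryDist E z) / bdryDist E z) := by field_simp
    have hint : ∫ w in ball z (bdryDist E z / 2), ‖fderiv ℂ f w‖ ^ p
        ≤ K ^ p * volume.real (ball z (bdryDist E z / 2)) := by
      refine (le_abs_self _).trans ?_
      rw [← Real.norm_eq_abs]
      refine norm_setIntegral_le_of_norm_le_const measure_ball_lt_top fun w hw => ?_
      rw [Real.norm_of_nonneg (by positivity)]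
      exact Real.rpow_le_rpow (norm_nonneg _) (hle w hw) hp.le
    rw [hmean z hz]
    refine le_trans ?_ (hconst hK0 (hvol z hz)).le
    have hint0 : 0 ≤ ∫ w in ball z (bdryDist E z / 2), ‖fderiv ℂ f w‖ ^ p :=
      integral_nonneg fun w => by positivity
    gcongr

end GradientMeans

/-! ### Assembly of the equivalences. -/

theorem MemLip.mono_of_norm_le {n : ℕ} {F G : Type*} [NormedAddCommGroup F] [NormedAddCommGroup G]
    {ψ : ℝ → ℝ} {E : Set (CSpace n)} {f : CSpace n → F} {g : CSpace n → G} (h : MemLip ψ E f)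
    (hle : ∀ z ∈ E, ∀ w ∈ E, ‖g z - g w‖ ≤ ‖f z - f w‖) : MemLip ψ E g := by
  obtain ⟨C, hC, hb⟩ := h
  exact ⟨C, hC, fun z hz w hw => (hle z hz w hw).trans (hb z hz w hw)⟩

theorem mainTheorem2 {n : ℕ} (hn : 1 ≤ n) {ψ : ℝ → ℝ} (hψ : IsFastMajorant ψ)
    {E : Set (CSpace n)} (hE : IsLipExtensionDomain ψ E)
    {f : CSpace n → ℂ} (hf : DifferentiableOn ℂ f E)
    {u v : CSpace n → ℝ} (huv : ∀ z ∈ E, f z = (u z : ℂ) + Complex.I * (v z : ℂ))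
    {p q : ℝ} (hp : AdmissibleExponent n p) (hq : AdmissibleExponent n q) :
    List.TFAE [
      MemLip ψ E u,
      GradBound ψ E u,
      MemLip ψ E (fun z => |u z|),
      GradMeanBound ψ E u p,
      MemLip ψ E v,
      GradBound ψ E v,
      MemLip ψ E (fun z => |v z|),
      GradMeanBound ψ E v q,
      MemLip ψ E f,
      MemLip ψ E (fun z => ‖f z‖),
      MemLipBdry ψ E (fun z => ‖f z‖)] := by
  have hm := hψ.toIsMajorant
  have hEo := hE.isOpen
  have hEu := hE.ne_univ
  have hu : ∀ z ∈ E, u z = (1 * f z).re := fun z hz => by simp [huv z hz]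
  have hv : ∀ z ∈ E, v z = (-Complex.I * f z).re := fun z hz => by simp [huv z hz]
  have hgu : ∀ z ∈ E, ‖realGrad u z‖ = ‖fderiv ℂ f z‖ := fun z hz =>
    norm_realGrad_eq_norm_fderiv (c := 1) (by simp) (hf.differentiableAt (hEo.mem_nhds hz))
      (eventually_of_mem (hEo.mem_nhds hz) hu)
  have hgv : ∀ z ∈ E, ‖realGrad v z‖ = ‖fderiv ℂ f z‖ := fun z hz =>
    norm_realGrad_eq_norm_fderiv (c := -Complex.I) (by simp)
      (hf.differentiableAt (hEo.mem_nhds hz)) (eventually_of_mem (hEo.mem_nhds hz) hv)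
  have h2 := gradBound_iff_derivBound (ψ := ψ) hgu
  have h6 := gradBound_iff_derivBound (ψ := ψ) hgv
  have h4 := gradMeanBound_iff_derivBound hm hEo hEu hf hp.1 hgu
  have h8 := gradMeanBound_iff_derivBound hm hEo hEu hf hq.1 hgv
  have h9 : DerivBound ψ E f → MemLip ψ E f := fun h =>
    (hE.memLip_iff f).2 (h.memLocLip hm hEo hEu hf)
  -- Statements 2, 4, 6 and 8 all become `DerivBound ψ E f`, so the implications among them are
  -- identities.
  rw [h2, h6, h4, h8]
  tfae_have 2 → 9 := h9
  tfae_have 2 → 4 := id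
  tfae_have 4 → 6 := id
  tfae_have 6 → 8 := id
  tfae_have 8 → 2 := id
  tfae_have 9 → 1 := fun h => h.mono_of_norm_le fun z hz w hw => by
    rw [hu z hz, hu w hw, one_mul, one_mul, ← Complex.sub_re, Real.norm_eq_abs]
    exact Complex.abs_re_le_norm _
  tfae_have 9 → 5 := fun h => h.mono_of_norm_le fun z hz w hw => by
    rw [hv z hz, hv w hw, ← Complex.sub_re, ← mul_sub, Real.norm_eq_abs]
    exact (Complex.abs_re_le_norm _).trans_eq (by simp)
  tfae_have 1 → 3 := fun h => h.mono_of_norm_le fun z _ w _ => by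
    simpa only [Real.norm_eq_abs] using abs_abs_sub_abs_le_abs_sub (u z) (u w)
  tfae_have 5 → 7 := fun h => h.mono_of_norm_le fun z _ w _ => by
    simpa only [Real.norm_eq_abs] using abs_abs_sub_abs_le_abs_sub (v z) (v w)
  tfae_have 3 → 2 := DerivBound.of_memLip_abs hm hEo hEu hf (by simp) hu
  tfae_have 7 → 2 := DerivBound.of_memLip_abs hm hEo hEu hf (by simp) hv
  tfae_have 9 → 10 := fun h => h.mono_of_norm_le fun z _ w _ => by
    simpa only [Real.norm_eq_abs] using abs_norm_sub_norm_le (f z) (f w)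
  tfae_have 10 → 11 := fun h => h.memLipBdry hm
  tfae_have 11 → 2 := DerivBound.of_memLipBdry_norm hm hEo hEu hf
  tfae_finish
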